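/- **Conventions.** All matrices are real and block sizes may be $0$. A control system $\Lambda=(A,B,C,D)$ is $\dot x=Ax+Bu,\ y=Cx+Du$ with $x\in\mathbb R^n$, $u\in\mathbb R^m$, $y\in\mathbb R^p$. A Morse transformation $(T_x,T_u,T_y,F,K)$, with $T_x,T_u,T_y$ invertible of sizes $n,m,p$, $F\in\mathbb R^{m\times n}$, $K\in\mathbb R^{n\times p}$, maps $(A,B,C,D)$ to the system $(A',B',C',D')$ with $$\begin{bmatrix}A'&B'\\C'&D'\end{bmatrix}=\begin{bmatrix}T_x&T_xK\\0&T_y\end{bmatrix}\begin{bmatrix}A&B\\C&D\end{bmatrix}\begin{bmatrix}T_x^{-1}&0\\FT_x^{-1}&T_u^{-1}\end{bmatrix};$$ the two systems are then called Morse equivalent. A system is *prime* if, up to a renumbering of the coordinates, it is Morse equivalent to independent chains of integrators, one for each input, i.e. $\dot x_{i,1}=x_{i,2},\dots,\dot x_{i,\sigma_i}=u_i,\ y_i=x_{i,1}$ with $\sigma_i\ge 0$, where a chain of length $\sigma_i=0$ is the static relation $y_i=u_i$. Spectra are sets of complex eigenvalues. **Proposition (Morse normal form).** Let $n=n_1+n_2+n_3+n_4$,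 $m=m_1+m_3$, $p=p_3+p_4$, and let $\tilde\Lambda=(\tilde A,\tilde B,\tilde C,\tilde D)$ be in Morse triangular form, i.e. $$\begin{bmatrix}\tilde A&\tilde B\\ \tilde C&\tilde D\end{bmatrix}=\left[\begin{array}{cccc|cc} \tilde A_1&\tilde A_1^2&\tilde A_1^3&\tilde A_1^4&\tilde B_1&\tilde B_1^2\\ 0&\tilde A_2&0&\tilde A_2^4&0&0\\ 0&0&\tilde A_3&\tilde A_3^4&0&\tilde B_3\\ 0&0&0&\tilde A_4&0&0\\ \hline 0&0&\tilde C_3&\tilde C_3^4&0&\tilde D_3\\ 0&0&0&\tilde C_4&0&0\end{array}\right]$$ (state blocks of sizes $n_1,n_2,n_3,n_4$, input blocks $m_1,m_3$, output blocks $p_3,p_4$), where $(\tilde A_1,\tilde B_1)$ is controllable, $(\tilde C_4,\tilde A_4)$ is observable and $(\tilde A_3,\tilde B_3,\tilde C_3,\tilde D_3)$ is prime. Then there exist $F_{MN}\in\mathbb R^{m\times n}$, $K_{MN}\in\mathbb R^{n\times p}$ and $T_{MN}\in Gl(n,\mathbb R)$ with the following properties. 1. The matrices $F_{MN}$, $K_{MN}$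 have the form $$F_{MN}=\begin{bmatrix}F^1&0&0&0\\0&0&F^2&F^3\end{bmatrix},\qquad K_{MN}=\begin{bmatrix}K^1&0\\0&0\\K^2&0\\0&K^3\end{bmatrix},$$ the Morse transformation $(I_n,I_m,I_p,F_{MN},K_{MN})$ maps $\tilde\Lambda$ to a system of the same block triangular shape, with blocks denoted $\bar A_1,\bar A_1^2,\bar A_1^3,\bar A_1^4,\bar A_2,\bar A_2^4,\bar A_3,\bar A_3^4,\bar A_4,\bar B_1,\bar B_1^2,\bar B_3,\bar C_3,\bar C_3^4,\bar C_4,\bar D_3$, and the spectra of $\bar A_1,\bar A_2,\bar A_3,\bar A_4$ are mutually disjoint. 2. There are matrices $T^1,\dots,T^5$ that solve the Sylvester equations $$\bar A_1T^1-T^1\bar A_2=-\bar A_1^2,\quad \bar A_2T^4-T^4\bar A_4=-\bar A_2^4,\quad \bar A_1T^3-T^3\bar A_4=-\bar A_1^4-\bar A_1^2T^4-\bar A_1^3T^5$$ and the constrained Sylvester equations $$\bar A_1T^2-T^2\bar A_3=-\bar A_1^3,\ \ T^2\bar B_3=\bar B_1^2;\qquad \bar A_3T^5-T^5\bar A_4=-\bar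 A_3^4,\ \ \bar C_3T^5=-\bar C_3^4,$$ and $$T_{MN}=\begin{bmatrix}I&T^1&T^2&T^3\\0&I&0&T^4\\0&0&I&T^5\\0&0&0&I\end{bmatrix}^{-1}.$$ 3. The Morse transformation $(T_{MN},I_m,I_p,F_{MN},K_{MN})$ maps $\tilde\Lambda$ to the system $(\bar A,\bar B,\bar C,\bar D)$ in Morse normal form $$\begin{bmatrix}\bar A&\bar B\\ \bar C&\bar D\end{bmatrix}=\left[\begin{array}{cccc|cc} \bar A_1&0&0&0&\bar B_1&0\\ 0&\bar A_2&0&0&0&0\\ 0&0&\bar A_3&0&0&\bar B_3\\ 0&0&0&\bar A_4&0&0\\ \hline 0&0&\bar C_3&0&0&\bar D_3\\ 0&0&0&\bar C_4&0&0\end{array}\right].$$ 4. The pair $(\bar A_1,\bar B_1)$ is controllable, the pair $(\bar C_4,\bar A_4)$ is observable, and $(\bar A_3,\bar B_3,\bar C_3,\bar D_3)$ is prime. -/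

import Mathlib

open Matrix

/-- A linear control system `ẋ = A x + B u`, `y = C x + D u` over `ℝ`, with the coordinates of the
state, input and output spaces indexed by `X`, `U`, `Y`. -/
@[ext]
structure ControlSystem (X U Y : Type) where
  A : Matrix X X ℝ
  B : Matrix X U ℝ
  C : Matrix Y X ℝ
  D : Matrix Y U ℝ

/-- The system matrix `[A B; C D]`. -/
def ControlSystem.toMatrix {X U Y : Type} (S : ControlSystem X U Y) :
    Matrix (X ⊕ Y) (X ⊕ U) ℝ :=
  Matrix.fromBlocks S.A S.B S.C S.D

/-- Renaming of the coordinates. -/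
def ControlSystem.reindex {X U Y X' U' Y' : Type} (eX : X ≃ X') (eU : U ≃ U') (eY : Y ≃ Y')
    (S : ControlSystem X U Y) : ControlSystem X' U' Y' where
  A := Matrix.reindex eX eX S.A
  B := Matrix.reindex eX eU S.B
  C := Matrix.reindex eY eX S.C
  D := Matrix.reindex eY eU S.D

/-- A Morse transformation `(T_x, T_u, T_y, F, K)`: coordinate changes in the state, input and
output spaces, a state feedback `F` and an output injection `K`. -/
structure MorseTransformation (X U Y : Type) [Fintype X] [DecidableEq X] [Fintype U]
    [DecidableEq U] [Fintype Y] [DecidableEq Y] where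
  Tx : GL X ℝ
  Tu : GL U ℝ
  Ty : GL Y ℝ
  F : Matrix U X ℝ
  K : Matrix X Y ℝ

section Morse

variable {X U Y : Type} [Fintype X] [DecidableEq X] [Fintype U] [DecidableEq U] [Fintype Y]
  [DecidableEq Y]

/-- The action of a Morse transformation on a system. -/
def MorseTransformation.apply (M : MorseTransformation X U Y) (S : ControlSystem X U Y) :
    ControlSystem X U Y where
  A := M.Tx.val * (S.A + S.B * M.F + M.K * S.C + M.K * S.D * M.F) * (M.Tx⁻¹).val
  B := M.Tx.val * (S.B + M.K * S.D) * (M.Tu⁻¹).val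
  C := M.Ty.val * (S.C + S.D * M.F) * (M.Tx⁻¹).val
  D := M.Ty.val * S.D * (M.Tu⁻¹).val

/-- The action is given by multiplying the system matrix by block triangular matrices. -/
theorem MorseTransformation.toMatrix_apply (M : MorseTransformation X U Y)
    (S : ControlSystem X U Y) :
    (M.apply S).toMatrix =
      Matrix.fromBlocks M.Tx.val (M.Tx.val * M.K) 0 M.Ty.val * S.toMatrix *
        Matrix.fromBlocks (M.Tx⁻¹).val 0 (M.F * (M.Tx⁻¹).val) (M.Tu⁻¹).val := by
  simp only [ControlSystem.toMatrix, MorseTransformation.apply, Matrix.fromBlocks_multiply]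
  congr 1 <;> simp only [Matrix.mul_add, Matrix.add_mul, Matrix.mul_assoc, Matrix.mul_zero,
    Matrix.zero_mul, zero_add]
  abel

/-- Morse equivalence of two systems. -/
def MorseEquivalent (S S' : ControlSystem X U Y) : Prop :=
  ∃ M : MorseTransformation X U Y, M.apply S = S'

/-- Controllability of `(A, B)`: the reachable subspace `Im B + A Im B + ⋯ + A ^ (n - 1) Im B` is
the whole state space. -/
def Controllable (A : Matrix X X ℝ) (B : Matrix X U ℝ) : Prop :=
  ⨆ k : Fin (Fintype.card X), LinearMap.range (A ^ (k : ℕ) * B).mulVecLin = ⊤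

/-- Observability of `(C, A)`: `ker C ∩ ker (C A) ∩ ⋯ ∩ ker (C A ^ (n - 1)) = 0`. -/
def Observable (C : Matrix Y X ℝ) (A : Matrix X X ℝ) : Prop :=
  ⨅ k : Fin (Fintype.card X), LinearMap.ker (C * A ^ (k : ℕ)).mulVecLin = ⊥

/-- One chain of integrators for each index `i : U`, of length `σ i`: the input `u i` drives
`x (i, 0)' = x (i, 1)`, …, `x (i, σ i - 1)' = u i`, and the output is `y i = x (i, 0)`. A chain of
length `0` is the static relation `y i = u i`. -/
def integratorChains (σ : U → ℕ) : ControlSystem (Σ i : U, Fin (σ i)) U U where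
  A := Matrix.of fun x x' => if x.1 = x'.1 ∧ (x.2 : ℕ) + 1 = (x'.2 : ℕ) then 1 else 0
  B := Matrix.of fun x i => if x.1 = i ∧ (x.2 : ℕ) + 1 = σ x.1 then 1 else 0
  C := Matrix.of fun i x => if x.1 = i ∧ (x.2 : ℕ) = 0 then 1 else 0
  D := Matrix.of fun i i' => if i = i' ∧ σ i = 0 then 1 else 0

/-- A system is prime if it is Morse equivalent to independent chains of integrators, one for each
input (so that there are as many outputs as inputs). -/
def ControlSystem.Prime (S : ControlSystem X U Y) : Prop :=
  ∃ (σ : U → ℕ) (eX : (Σ i : U, Fin (σ i)) ≃ X) (eY : U ≃ Y),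
    MorseEquivalent S ((integratorChains σ).reindex eX (Equiv.refl U) eY)

/-- The two real matrices have no common complex eigenvalue. -/
def DisjointSpectra {X' : Type} [Fintype X'] [DecidableEq X']
    (A : Matrix X X ℝ) (A' : Matrix X' X' ℝ) : Prop :=
  Disjoint (spectrum ℂ (A.map Complex.ofReal)) (spectrum ℂ (A'.map Complex.ofReal))

end Morse

/-- The matrix with a `4 × 4` array of blocks. -/
def block44 {X₁ X₂ X₃ X₄ : Type}
    (M₁₁ : Matrix X₁ X₁ ℝ) (M₁₂ : Matrix X₁ X₂ ℝ) (M₁₃ : Matrix X₁ X₃ ℝ) (M₁₄ : Matrix X₁ X₄ ℝ)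
    (M₂₁ : Matrix X₂ X₁ ℝ) (M₂₂ : Matrix X₂ X₂ ℝ) (M₂₃ : Matrix X₂ X₃ ℝ) (M₂₄ : Matrix X₂ X₄ ℝ)
    (M₃₁ : Matrix X₃ X₁ ℝ) (M₃₂ : Matrix X₃ X₂ ℝ) (M₃₃ : Matrix X₃ X₃ ℝ) (M₃₄ : Matrix X₃ X₄ ℝ)
    (M₄₁ : Matrix X₄ X₁ ℝ) (M₄₂ : Matrix X₄ X₂ ℝ) (M₄₃ : Matrix X₄ X₃ ℝ) (M₄₄ : Matrix X₄ X₄ ℝ) :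
    Matrix ((X₁ ⊕ X₂) ⊕ (X₃ ⊕ X₄)) ((X₁ ⊕ X₂) ⊕ (X₃ ⊕ X₄)) ℝ :=
  Matrix.fromBlocks
    (Matrix.fromBlocks M₁₁ M₁₂ M₂₁ M₂₂) (Matrix.fromBlocks M₁₃ M₁₄ M₂₃ M₂₄)
    (Matrix.fromBlocks M₃₁ M₃₂ M₄₁ M₄₂) (Matrix.fromBlocks M₃₃ M₃₄ M₄₃ M₄₄)

/-- The matrix with a `4 × 2` array of blocks. -/
def block42 {X₁ X₂ X₃ X₄ Z Z' : Type}
    (M₁ : Matrix X₁ Z ℝ) (M₁' : Matrix X₁ Z' ℝ)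
    (M₂ : Matrix X₂ Z ℝ) (M₂' : Matrix X₂ Z' ℝ)
    (M₃ : Matrix X₃ Z ℝ) (M₃' : Matrix X₃ Z' ℝ)
    (M₄ : Matrix X₄ Z ℝ) (M₄' : Matrix X₄ Z' ℝ) :
    Matrix ((X₁ ⊕ X₂) ⊕ (X₃ ⊕ X₄)) (Z ⊕ Z') ℝ :=
  Matrix.fromRows (Matrix.fromBlocks M₁ M₁' M₂ M₂') (Matrix.fromBlocks M₃ M₃' M₄ M₄')

/-- The matrix with a `2 × 4` array of blocks. -/
def block24 {X₁ X₂ X₃ X₄ Z Z' : Type}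
    (M₁ : Matrix Z X₁ ℝ) (M₂ : Matrix Z X₂ ℝ) (M₃ : Matrix Z X₃ ℝ) (M₄ : Matrix Z X₄ ℝ)
    (M₁' : Matrix Z' X₁ ℝ) (M₂' : Matrix Z' X₂ ℝ) (M₃' : Matrix Z' X₃ ℝ) (M₄' : Matrix Z' X₄ ℝ) :
    Matrix (Z ⊕ Z') ((X₁ ⊕ X₂) ⊕ (X₃ ⊕ X₄)) ℝ :=
  Matrix.fromCols (Matrix.fromBlocks M₁ M₂ M₁' M₂') (Matrix.fromBlocks M₃ M₄ M₃' M₄')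

/-- The coordinates of a state space that is split into four blocks. -/
abbrev State4 (n₁ n₂ n₃ n₄ : ℕ) : Type := (Fin n₁ ⊕ Fin n₂) ⊕ (Fin n₃ ⊕ Fin n₄)

/-- The blocks of a system of Morse triangular shape. -/
structure TriangularBlocks (n₁ n₂ n₃ n₄ m₁ m₃ p₃ p₄ : ℕ) where
  A₁ : Matrix (Fin n₁) (Fin n₁) ℝ
  A₁₂ : Matrix (Fin n₁) (Fin n₂) ℝ
  A₁₃ : Matrix (Fin n₁) (Fin n₃) ℝ
  A₁₄ : Matrix (Fin n₁) (Fin n₄) ℝ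
  A₂ : Matrix (Fin n₂) (Fin n₂) ℝ
  A₂₄ : Matrix (Fin n₂) (Fin n₄) ℝ
  A₃ : Matrix (Fin n₃) (Fin n₃) ℝ
  A₃₄ : Matrix (Fin n₃) (Fin n₄) ℝ
  A₄ : Matrix (Fin n₄) (Fin n₄) ℝ
  B₁ : Matrix (Fin n₁) (Fin m₁) ℝ
  B₁₂ : Matrix (Fin n₁) (Fin m₃) ℝ
  B₃ : Matrix (Fin n₃) (Fin m₃) ℝ
  C₃ : Matrix (Fin p₃) (Fin n₃) ℝ
  C₃₄ : Matrix (Fin p₃) (Fin n₄) ℝ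
  C₄ : Matrix (Fin p₄) (Fin n₄) ℝ
  D₃ : Matrix (Fin p₃) (Fin m₃) ℝ

section Forms

variable {n₁ n₂ n₃ n₄ m₁ m₃ p₃ p₄ : ℕ}

/-- The system of Morse triangular shape with the given blocks. -/
def TriangularBlocks.toSystem (S : TriangularBlocks n₁ n₂ n₃ n₄ m₁ m₃ p₃ p₄) :
    ControlSystem (State4 n₁ n₂ n₃ n₄) (Fin m₁ ⊕ Fin m₃) (Fin p₃ ⊕ Fin p₄) where
  A := block44
    S.A₁ S.A₁₂ S.A₁₃ S.A₁₄
    0    S.A₂  0     S.A₂₄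
    0    0     S.A₃  S.A₃₄
    0    0     0     S.A₄
  B := block42
    S.B₁ S.B₁₂
    0    0
    0    S.B₃
    0    0
  C := block24
    0 0 S.C₃ S.C₃₄
    0 0 0    S.C₄
  D := Matrix.fromBlocks
    0 S.D₃
    0 0

/-- The three conditions that the blocks of a Morse triangular (or Morse normal) form satisfy. -/
structure TriangularBlocks.Admissible (S : TriangularBlocks n₁ n₂ n₃ n₄ m₁ m₃ p₃ p₄) : Prop where
  controllable : Controllable S.A₁ S.B₁
  observable : Observable S.C₄ S.A₄
  prime : (ControlSystem.mk S.A₃ S.B₃ S.C₃ S.D₃).Prime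

/-- The block diagonal system formed by the diagonal blocks. -/
def TriangularBlocks.diagonalSystem (S : TriangularBlocks n₁ n₂ n₃ n₄ m₁ m₃ p₃ p₄) :
    ControlSystem (State4 n₁ n₂ n₃ n₄) (Fin m₁ ⊕ Fin m₃) (Fin p₃ ⊕ Fin p₄) where
  A := block44
    S.A₁ 0    0    0
    0    S.A₂ 0    0
    0    0    S.A₃ 0
    0    0    0    S.A₄
  B := block42
    S.B₁ 0
    0    0
    0    S.B₃
    0    0
  C := block24
    0 0 S.C₃ 0
    0 0 0    S.C₄
  D := Matrix.fromBlocks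
    0 S.D₃
    0 0

/-- The spectra of the four diagonal blocks are mutually disjoint. -/
structure TriangularBlocks.MutuallyDisjointSpectra
    (S : TriangularBlocks n₁ n₂ n₃ n₄ m₁ m₃ p₃ p₄) : Prop where
  h₁₂ : DisjointSpectra S.A₁ S.A₂
  h₁₃ : DisjointSpectra S.A₁ S.A₃
  h₁₄ : DisjointSpectra S.A₁ S.A₄
  h₂₃ : DisjointSpectra S.A₂ S.A₃
  h₂₄ : DisjointSpectra S.A₂ S.A₄
  h₃₄ : DisjointSpectra S.A₃ S.A₄

/-- The Sylvester equations and the constrained Sylvester equations for the blocks of the state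
transformation. -/
structure TriangularBlocks.SylvesterEquations (S : TriangularBlocks n₁ n₂ n₃ n₄ m₁ m₃ p₃ p₄)
    (T₁ : Matrix (Fin n₁) (Fin n₂) ℝ) (T₂ : Matrix (Fin n₁) (Fin n₃) ℝ)
    (T₃ : Matrix (Fin n₁) (Fin n₄) ℝ) (T₄ : Matrix (Fin n₂) (Fin n₄) ℝ)
    (T₅ : Matrix (Fin n₃) (Fin n₄) ℝ) : Prop where
  eq₁ : S.A₁ * T₁ - T₁ * S.A₂ = -S.A₁₂
  eq₄ : S.A₂ * T₄ - T₄ * S.A₄ = -S.A₂₄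
  eq₃ : S.A₁ * T₃ - T₃ * S.A₄ = -S.A₁₄ - S.A₁₂ * T₄ - S.A₁₃ * T₅
  eq₂ : S.A₁ * T₂ - T₂ * S.A₃ = -S.A₁₃
  constraint₂ : T₂ * S.B₃ = S.B₁₂
  eq₅ : S.A₃ * T₅ - T₅ * S.A₄ = -S.A₃₄
  constraint₅ : S.C₃ * T₅ = -S.C₃₄

end Forms

/-! Feedback and injection serve two purposes: separating spectra and making the constrained
Sylvester equations solvable. The second block cannot be moved, but `F₁` moves `A₁`, `K₃` moves `A₄`
and `F₂` moves `A₃`. For a controllable pair, `det (z - A - B F)` is a nonzero polynomial in the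
entries of `F` for every complex `z`, by the Hautus test. The product of these polynomials over a
finite set of `z` is again nonzero, so it does not vanish at some real `F`
(`Hautus.exists_feedback_disjoint`). Observability is dual, and a prime system satisfies the Hautus
test.

The parameters `K₁` and `F₃` do not touch the diagonal blocks. They enter the two constrained
equations linearly, as additional unknowns next to `T₂` and `T₅`. Since a prime system has as many
outputs as inputs, the resulting linear systems are square, so it is enough that their kernels
vanish. Kernels are transported by Morse transformations, and for chains of integrators they are
zero by running along each chain (`ControlSystem.Prime.exists_left`,
`ControlSystem.Prime.exists_right`). No spectral condition is needed here.

The remaining three equations are ordinary Sylvester equations between blocks with disjoint spectra.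
Together the equations say exactly that the unitriangular matrix of the `Tᵢ` intertwines the
triangular system with its diagonal part. -/

/-! ### Controllability, observability and the Hautus test -/

section PBH

variable {X U Y : Type} [Fintype X] [DecidableEq X] [Fintype U] [Fintype Y]

/-- No nonzero row vector annihilates the controllability matrix. -/
theorem controllable_iff_vecMul (A : Matrix X X ℝ) (B : Matrix X U ℝ) :
    Controllable A B ↔
      ∀ w : X → ℝ, (∀ k < Fintype.card X, w ᵥ* (A ^ k * B) = 0) → w = 0 := by
  unfold Controllable
  constructor
  · intro h w hw
    have hle : (⊤ : Submodule ℝ (X → ℝ)) ≤ LinearMap.ker (dotProductEquiv ℝ X w) := by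
      rw [← h, iSup_le_iff]
      rintro k _ ⟨u, rfl⟩
      simp [Matrix.dotProduct_mulVec, hw k k.2]
    apply (dotProductEquiv ℝ X).injective
    rw [map_zero]
    exact LinearMap.ker_eq_top.mp (top_le_iff.mp hle)
  · intro h
    by_contra hne
    obtain ⟨f, hf, hf'⟩ := Submodule.exists_dual_map_eq_bot_of_lt_top (lt_top_iff_ne_top.mpr hne)
      inferInstance
    obtain ⟨w, rfl⟩ := (dotProductEquiv ℝ X).surjective f
    refine hf ?_
    rw [h w, map_zero]
    intro k hk
    apply dotProduct_eq_zero
    intro u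
    rw [← Matrix.dotProduct_mulVec]
    have hmem : (A ^ k * B) *ᵥ u ∈
        ⨆ k : Fin (Fintype.card X), LinearMap.range (A ^ (k : ℕ) * B).mulVecLin :=
      Submodule.mem_iSup_of_mem ⟨k, hk⟩ ⟨u, rfl⟩
    have := Submodule.mem_map_of_mem (f := dotProductEquiv ℝ X w) hmem
    rw [hf'] at this
    simpa using this

/-- Observability is controllability of the transposed pair. -/
theorem observable_iff_controllable_transpose (C : Matrix Y X ℝ) (A : Matrix X X ℝ) :
    Observable C A ↔ Controllable Aᵀ Cᵀ := by
  rw [controllable_iff_vecMul, Observable, Submodule.eq_bot_iff]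
  refine forall_congr' fun w => imp_congr_left ?_
  simp only [Submodule.mem_iInf, LinearMap.mem_ker, Matrix.mulVecLin_apply, Fin.forall_iff,
    ← Matrix.transpose_pow, ← Matrix.transpose_mul, Matrix.vecMul_transpose]

/-- State feedback preserves controllability. -/
theorem Controllable.add_mul {A : Matrix X X ℝ} {B : Matrix X U ℝ} (h : Controllable A B)
    (F : Matrix U X ℝ) : Controllable (A + B * F) B := by
  rw [controllable_iff_vecMul] at h ⊢
  intro w hw
  -- The terms containing `F` drop out one power at a time, because `w` annihilates each `(A + B F)
  -- ^ k B`.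
  have hpow : ∀ k ≤ Fintype.card X, w ᵥ* (A + B * F) ^ k = w ᵥ* A ^ k := by
    intro k
    induction k with
    | zero => simp
    | succ k ih =>
      intro hk
      have h0 := hw k hk
      rw [← Matrix.vecMul_vecMul, ih (by omega)] at h0
      rw [pow_succ, ← Matrix.vecMul_vecMul, ih (by omega), Matrix.vecMul_add,
        ← Matrix.vecMul_vecMul _ B, h0, Matrix.zero_vecMul, add_zero, Matrix.vecMul_vecMul,
        ← pow_succ]
  refine h w fun k hk => ?_
  rw [← Matrix.vecMul_vecMul, ← hpow k hk.le, Matrix.vecMul_vecMul, hw k hk]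

/-- Output injection preserves observability. -/
theorem Observable.add_mul {C : Matrix Y X ℝ} {A : Matrix X X ℝ} (h : Observable C A)
    (K : Matrix X Y ℝ) : Observable C (A + K * C) := by
  rw [observable_iff_controllable_transpose] at h ⊢
  simpa using h.add_mul Kᵀ

/-- The Hautus condition in a real form: a family of row vectors that spans an `A`-invariant space
and is annihilated by `B` vanishes. -/
def Hautus {X U : Type} [Fintype X] (A : Matrix X X ℝ) (B : Matrix X U ℝ) : Prop :=
  ∀ (k : ℕ) (P : Matrix (Fin k) (Fin k) ℝ) (T : Matrix (Fin k) X ℝ),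
    T * A = P * T → T * B = 0 → T = 0

/-- Invariance gives `T A ^ j B = P ^ j T B = 0`, so every row of `T` annihilates the
controllability matrix. -/
theorem Controllable.hautus {A : Matrix X X ℝ} {B : Matrix X U ℝ} (h : Controllable A B) :
    Hautus A B := by
  rw [controllable_iff_vecMul] at h
  intro k P T hA hB
  have hpow : ∀ j : ℕ, T * A ^ j = P ^ j * T := by
    intro j
    induction j with
    | zero => simp
    | succ j ih => rw [pow_succ, ← Matrix.mul_assoc, ih, Matrix.mul_assoc, hA, pow_succ,
        Matrix.mul_assoc]
  have hrow : ∀ i, T i = 0 := fun i => h _ fun j _ => by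
    have : T * (A ^ j * B) = 0 := by
      rw [← Matrix.mul_assoc, hpow, Matrix.mul_assoc, hB, Matrix.mul_zero]
    rw [← Matrix.mul_apply_eq_vecMul, this]
    rfl
  ext i j
  simp [hrow i]

/-- The Hautus condition for complex row vectors. -/
theorem Hautus.complex {X U : Type} [Fintype X] {A : Matrix X X ℝ} {B : Matrix X U ℝ} (h : Hautus A B) (z : ℂ)
    (w : X → ℂ) (hA : w ᵥ* A.map Complex.ofReal = z • w) (hB : w ᵥ* B.map Complex.ofReal = 0) :
    w = 0 := by
  -- The real and imaginary parts of `w` are the two rows of `T`; multiplication by `z` acts on them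
  -- through the usual real `2 × 2` matrix.
  have hT := h 2 !![z.re, -z.im; z.im, z.re] (Matrix.of ![fun x => (w x).re, fun x => (w x).im])
    (by
      ext i x
      have hx := congrFun hA x
      simp only [Matrix.vecMul, dotProduct, Matrix.map_apply, Pi.smul_apply, smul_eq_mul] at hx
      have hre := congrArg Complex.re hx
      have him := congrArg Complex.im hx
      fin_cases i
      · simpa [Matrix.mul_apply, Fin.sum_univ_two, sub_eq_add_neg] using hre
      · simpa [Matrix.mul_apply, Fin.sum_univ_two, add_comm] using him)
    (by
      ext i x
      have hx := congrFun hB x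
      simp only [Matrix.vecMul, dotProduct, Matrix.map_apply, Pi.zero_apply] at hx
      have hre := congrArg Complex.re hx
      have him := congrArg Complex.im hx
      fin_cases i
      · simpa [Matrix.mul_apply] using hre
      · simpa [Matrix.mul_apply] using him)
  ext x
  exact Complex.ext (by simpa using congrFun (congrFun hT 0) x)
    (by simpa using congrFun (congrFun hT 1) x)

end PBH

/-! ### Moving the spectrum by feedback -/

/-- If the ranges of an endomorphism `M` and of `B` span the space, then `M` becomes invertible by
adding some `B ∘ F`. -/
theorem exists_ker_add_comp_eq_bot {k V W : Type*} [Field k] [AddCommGroup V] [Module k V]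
    [FiniteDimensional k V] [AddCommGroup W] [Module k W] (M : V →ₗ[k] V) (B : W →ₗ[k] V)
    (h : LinearMap.range M ⊔ LinearMap.range B = ⊤) :
    ∃ F : V →ₗ[k] W, LinearMap.ker (M + B ∘ₗ F) = ⊥ := by
  have hsurj : LinearMap.range ((LinearMap.range M).mkQ ∘ₗ B) = ⊤ := by
    rw [LinearMap.range_comp, Submodule.map_mkQ_eq_top, h]
  obtain ⟨s, hs⟩ := LinearMap.exists_rightInverse_of_surjective _ hsurj
  have hdim : Module.finrank k (LinearMap.ker M) = Module.finrank k (V ⧸ LinearMap.range M) := by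
    have h1 := LinearMap.finrank_range_add_finrank_ker M
    have h2 := Submodule.finrank_quotient_add_finrank (LinearMap.range M)
    omega
  -- Kernel and cokernel of `M` have the same dimension. The map `F` projects to the kernel,
  -- identifies it with the cokernel and lifts the result through `B`.
  let e := LinearEquiv.ofFinrankEq _ _ hdim
  obtain ⟨π, hπ⟩ := LinearMap.exists_leftInverse_of_injective (LinearMap.ker M).subtype
    (Submodule.ker_subtype _)
  refine ⟨s ∘ₗ e.toLinearMap ∘ₗ π, (Submodule.eq_bot_iff _).mpr fun v hv => ?_⟩
  have hv' : M v + B (s (e (π v))) = 0 := hv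
  -- Modulo the range of `M` only `e (π v)` survives. Hence `π v = 0`, then `M v = 0`, and on the
  -- kernel `π v` is `v` itself.
  have hq := congrArg (LinearMap.range M).mkQ hv'
  have hM : (LinearMap.range M).mkQ (M v) = 0 := by simp
  have hs' : (LinearMap.range M).mkQ (B (s (e (π v)))) = e (π v) :=
    LinearMap.congr_fun hs (e (π v))
  rw [map_add, hM, hs', zero_add, map_zero, LinearEquiv.map_eq_zero_iff] at hq
  rw [hq, map_zero, map_zero, map_zero, add_zero] at hv'
  have := LinearMap.congr_fun hπ ⟨v, hv'⟩
  simp only [LinearMap.comp_apply, Submodule.subtype_apply, LinearMap.id_apply, hq] at this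
  exact (congrArg Subtype.val this).symm

section PoleShift

variable {X U Y : Type} [Fintype X] [DecidableEq X] [Fintype U] [Fintype Y]

/-- A row vector orthogonal to the ranges of `z - A` and `B` is a left eigenvector annihilated by
`B`, hence zero. So the two ranges span. The feedback found here is complex and depends on `z`; it
only serves to show that a polynomial is nonzero. -/
theorem Hautus.exists_det_ne_zero [DecidableEq U] {A : Matrix X X ℝ} {B : Matrix X U ℝ} (h : Hautus A B) (z : ℂ) :
    ∃ F : Matrix U X ℂ,
      (Matrix.scalar X z - A.map Complex.ofReal - B.map Complex.ofReal * F).det ≠ 0 := by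
  obtain ⟨F, hF⟩ := exists_ker_add_comp_eq_bot
    (Matrix.toLin' (Matrix.scalar X z - A.map Complex.ofReal))
    (Matrix.toLin' (-B.map Complex.ofReal)) (by
      by_contra hne
      obtain ⟨f, hf, hf'⟩ := Submodule.exists_dual_map_eq_bot_of_lt_top
        (lt_top_iff_ne_top.mpr hne) inferInstance
      obtain ⟨w, rfl⟩ := (dotProductEquiv ℂ X).surjective f
      have hmem : ∀ v ∈ LinearMap.range (Matrix.toLin' (Matrix.scalar X z - A.map Complex.ofReal)) ⊔
          LinearMap.range (Matrix.toLin' (-B.map Complex.ofReal)), w ⬝ᵥ v = 0 := fun v hv => by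
        have := Submodule.mem_map_of_mem (f := dotProductEquiv ℂ X w) hv
        rw [hf'] at this
        simpa using this
      refine hf ?_
      rw [h.complex z w, map_zero]
      · symm
        rw [← sub_eq_zero]
        apply dotProduct_eq_zero
        intro v
        have := hmem _ (Submodule.mem_sup_left ⟨v, rfl⟩)
        rw [Matrix.toLin'_apply, Matrix.dotProduct_mulVec, Matrix.vecMul_sub] at this
        simpa [Matrix.vecMul_smul, Matrix.scalar_apply, ← Matrix.smul_one_eq_diagonal] using this
      · apply dotProduct_eq_zero
        intro v
        have := hmem _ (Submodule.mem_sup_right ⟨v, rfl⟩)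
        rw [Matrix.toLin'_apply, Matrix.dotProduct_mulVec, Matrix.vecMul_neg] at this
        simpa using this)
  refine ⟨LinearMap.toMatrix' F, fun hdet => ?_⟩
  obtain ⟨v, hv, hv'⟩ := Matrix.exists_mulVec_eq_zero_iff.mpr hdet
  refine hv ((Submodule.eq_bot_iff _).mp hF v ?_)
  rw [LinearMap.mem_ker, ← hv', LinearMap.add_apply, LinearMap.comp_apply, Matrix.toLin'_apply,
    Matrix.toLin'_apply, Matrix.sub_mulVec _ (B.map Complex.ofReal * _), ← Matrix.mulVec_mulVec,
    LinearMap.toMatrix'_mulVec, Matrix.neg_mulVec, ← sub_eq_add_neg]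

/-- By state feedback the eigenvalues can be moved away from any finite set. -/
theorem Hautus.exists_feedback_disjoint {A : Matrix X X ℝ} {B : Matrix X U ℝ} (h : Hautus A B)
    {s : Set ℂ} (hs : s.Finite) :
    ∃ F : Matrix U X ℝ, Disjoint (spectrum ℂ ((A + B * F).map Complex.ofReal)) s := by
  classical
  -- The determinant of `z - A - B F`, with the entries of `F` as indeterminates.
  let p : ℂ → MvPolynomial (U × X) ℂ := fun z =>
    (Matrix.of fun i j => MvPolynomial.C ((Matrix.scalar X z - A.map Complex.ofReal) i j)
      - ∑ l, MvPolynomial.C (B i l : ℂ) * MvPolynomial.X (l, j)).det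
  have hp : ∀ (z : ℂ) (x : U × X → ℂ), MvPolynomial.eval x (p z) =
      (Matrix.scalar X z - A.map Complex.ofReal
        - B.map Complex.ofReal * Matrix.of fun i j => x (i, j)).det := by
    intro z x
    rw [RingHom.map_det]
    congr 1
    ext i j
    simp [Matrix.mul_apply]
  have hprod : ∏ z ∈ hs.toFinset, p z ≠ 0 := by
    refine Finset.prod_ne_zero_iff.mpr fun z _ hz => ?_
    obtain ⟨F, hF⟩ := h.exists_det_ne_zero z
    have := hp z fun i => F i.1 i.2
    rw [hz, map_zero] at this
    exact hF this.symm
  have hex : ∃ x : U × X → ℝ,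
      MvPolynomial.eval (fun i => (x i : ℂ)) (∏ z ∈ hs.toFinset, p z) ≠ 0 := by
    by_contra! hall
    -- A complex polynomial that vanishes at all real points is zero, since `ℝ` is an infinite
    -- subset of `ℂ`.
    refine hprod (MvPolynomial.funext_set (fun _ => Set.range Complex.ofReal)
      (fun _ => Set.infinite_range_of_injective Complex.ofReal_injective) fun x hx => ?_)
    choose y hy using fun i => hx i (Set.mem_univ i)
    rw [map_zero, ← hall y]
    simp only [hy]
  obtain ⟨x, hx⟩ := hex
  refine ⟨Matrix.of fun i j => x (i, j), Set.disjoint_left.mpr fun z hz hzs => hx ?_⟩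
  rw [map_prod]
  refine Finset.prod_eq_zero (hs.mem_toFinset.mpr hzs) ?_
  rw [hp]
  rw [spectrum.mem_iff, Matrix.isUnit_iff_isUnit_det, isUnit_iff_ne_zero, not_not] at hz
  rw [← hz]
  congr 1
  ext i j
  simp [Matrix.mul_apply, Matrix.algebraMap_matrix_apply, Matrix.diagonal_apply, sub_sub]

/-- By output injection the eigenvalues of an observable pair can be moved away from any finite
set. -/
theorem Observable.exists_injection_disjoint {C : Matrix Y X ℝ} {A : Matrix X X ℝ}
    (h : Observable C A) {s : Set ℂ} (hs : s.Finite) :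
    ∃ K : Matrix X Y ℝ, Disjoint (spectrum ℂ ((A + K * C).map Complex.ofReal)) s := by
  obtain ⟨F, hF⟩ :=
    ((observable_iff_controllable_transpose C A).mp h).hautus.exists_feedback_disjoint hs
  refine ⟨Fᵀ, ?_⟩
  convert hF using 1
  ext z
  rw [Matrix.mem_spectrum_iff_isRoot_charpoly, Matrix.mem_spectrum_iff_isRoot_charpoly,
    ← Matrix.charpoly_transpose]
  congr! 2
  rw [← Matrix.transpose_map]
  simp

end PoleShift

/-! ### Sylvester equations -/

section Sylvester

variable {X X' : Type} [Fintype X] [DecidableEq X] [Fintype X'] [DecidableEq X']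

/-- The relation extends to `p(A) T = T p(A')` for every polynomial `p`. For the characteristic
polynomial of `A` the left side vanishes by Cayley–Hamilton, while `p(A')` is invertible by spectral
mapping. -/
theorem DisjointSpectra.eq_zero_of_mul_eq_mul {A : Matrix X X ℝ} {A' : Matrix X' X' ℝ}
    (h : DisjointSpectra A A') {T : Matrix X X' ℝ} (hT : A * T = T * A') : T = 0 := by
  cases isEmpty_or_nonempty X'
  · exact Subsingleton.elim _ _
  set a := A.map Complex.ofReal
  set a' := A'.map Complex.ofReal
  set t := T.map Complex.ofReal
  have ht : a * t = t * a' := by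
    have := congrArg (fun M => M.map Complex.ofRealHom) hT
    simpa only [Matrix.map_mul] using! this
  have hpow : ∀ k : ℕ, a ^ k * t = t * a' ^ k := by
    intro k
    induction k with
    | zero => simp
    | succ k ih => rw [pow_succ, Matrix.mul_assoc, ht, ← Matrix.mul_assoc, ih, Matrix.mul_assoc,
        ← pow_succ]
  have hpoly : ∀ p : Polynomial ℂ, Polynomial.aeval a p * t = t * Polynomial.aeval a' p := by
    intro p
    simp only [Polynomial.aeval_eq_sum_range, Matrix.sum_mul, Matrix.mul_sum,
      Matrix.smul_mul, Matrix.mul_smul, hpow]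
  have h0 : t * Polynomial.aeval a' a.charpoly = 0 := by
    rw [← hpoly, Matrix.aeval_self_charpoly, Matrix.zero_mul]
  have hunit : IsUnit (Polynomial.aeval a' a.charpoly) := by
    rw [← spectrum.zero_notMem_iff ℂ, spectrum.map_polynomial_aeval_of_nonempty _ _
      (spectrum.nonempty_of_isAlgClosed_of_finiteDimensional ℂ a')]
    rintro ⟨z, hz, hz'⟩
    exact Set.disjoint_left.mp h (Matrix.mem_spectrum_iff_isRoot_charpoly.mpr hz') hz
  obtain ⟨u, hu⟩ := hunit
  have ht0 : t = 0 := by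
    rw [← hu] at h0
    calc t = t * (u.val * u⁻¹.val) := by rw [u.mul_inv, Matrix.mul_one]
      _ = 0 := by rw [← Matrix.mul_assoc, h0, Matrix.zero_mul]
  ext i j
  exact Complex.ofReal_injective (congrFun (congrFun ht0 i) j)

/-- The Sylvester equation is solvable if the spectra are disjoint. -/
theorem DisjointSpectra.exists_sylvester {A : Matrix X X ℝ} {A' : Matrix X' X' ℝ}
    (h : DisjointSpectra A A') (G : Matrix X X' ℝ) : ∃ T : Matrix X X' ℝ, A * T - T * A' = G := by
  let f : Matrix X X' ℝ →ₗ[ℝ] Matrix X X' ℝ :=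
    { toFun := fun T => A * T - T * A'
      map_add' := fun T T' => by rw [Matrix.mul_add, Matrix.add_mul]; abel
      map_smul' := fun c T => by simp [smul_sub] }
  have hf : Function.Injective f := (injective_iff_map_eq_zero f).mpr fun T hT =>
    h.eq_zero_of_mul_eq_mul (sub_eq_zero.mp hT)
  exact (LinearMap.injective_iff_surjective.mp hf) G

end Sylvester

/-! ### Prime systems and constrained Sylvester equations -/

section Prime

variable {X U Y Z : Type} [Fintype X] [DecidableEq X] [Fintype U] [DecidableEq U] [Fintype Y]
  [DecidableEq Y]

/-- State feedback preserves primeness. -/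
theorem ControlSystem.Prime.feedback {S : ControlSystem X U Y} (h : S.Prime) (F : Matrix U X ℝ) :
    (ControlSystem.mk (S.A + S.B * F) S.B (S.C + S.D * F) S.D).Prime := by
  obtain ⟨σ, eX, eY, M, hM⟩ := h
  -- The same chains are reached by first undoing `F`.
  refine ⟨σ, eX, eY, ⟨M.Tx, M.Tu, M.Ty, M.F - F, M.K⟩, ?_⟩
  rw [← hM]
  have hA : S.A + S.B * F + S.B * (M.F - F) + M.K * (S.C + S.D * F) + M.K * S.D * (M.F - F) =
      S.A + S.B * M.F + M.K * S.C + M.K * S.D * M.F := by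
    simp only [Matrix.mul_add, Matrix.mul_sub, Matrix.mul_assoc]
    abel
  have hC : S.C + S.D * F + S.D * (M.F - F) = S.C + S.D * M.F := by
    simp only [Matrix.mul_sub]
    abel
  simp only [MorseTransformation.apply, hA, hC]

/-- `(T, K)` is a solution of the homogeneous constrained Sylvester equation. -/
def ControlSystem.LeftKernel [Fintype Z] (S : ControlSystem X U Y) (P : Matrix Z Z ℝ) (T : Matrix Z X ℝ)
    (K : Matrix Z Y ℝ) : Prop :=
  T * S.A = P * T + K * S.C ∧ T * S.B = K * S.D

/-- `(T, F)` is a solution of the homogeneous dual constrained Sylvester equation. -/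
def ControlSystem.RightKernel [Fintype Z] (S : ControlSystem X U Y) (P : Matrix Z Z ℝ) (T : Matrix X Z ℝ)
    (F : Matrix U Z ℝ) : Prop :=
  S.A * T = T * P + S.B * F ∧ S.C * T = S.D * F

/-- `P` is unchanged and the injection of `M` shifts `K`; the feedback of `M` contributes nothing
new because `T B = K D`. -/
theorem ControlSystem.LeftKernel.apply [Fintype Z]
    {S : ControlSystem X U Y} {P : Matrix Z Z ℝ}
    {T : Matrix Z X ℝ} {K : Matrix Z Y ℝ} (h : S.LeftKernel P T K)
    (M : MorseTransformation X U Y) :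
    (M.apply S).LeftKernel P (T * (M.Tx⁻¹).val) ((K + T * M.K) * (M.Ty⁻¹).val) := by
  obtain ⟨hA, hB⟩ := h
  have hx : ∀ {V : Type} (N : Matrix X V ℝ), (M.Tx⁻¹).val * (M.Tx.val * N) = N := fun N => by
    rw [← Matrix.mul_assoc, M.Tx.inv_mul, Matrix.one_mul]
  have hy : ∀ {V : Type} (N : Matrix Y V ℝ), (M.Ty⁻¹).val * (M.Ty.val * N) = N := fun N => by
    rw [← Matrix.mul_assoc, M.Ty.inv_mul, Matrix.one_mul]
  constructor
  · have : T * (S.A + S.B * M.F + M.K * S.C + M.K * S.D * M.F) =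
        P * T + (K + T * M.K) * (S.C + S.D * M.F) := by
      simp only [Matrix.mul_add, Matrix.add_mul, ← Matrix.mul_assoc, hA, hB]
      abel
    simp only [MorseTransformation.apply, Matrix.mul_assoc, hx, hy]
    simp only [← Matrix.mul_assoc] at this ⊢
    rw [this, Matrix.add_mul]
  · have : T * (S.B + M.K * S.D) = (K + T * M.K) * S.D := by
      simp only [Matrix.mul_add, Matrix.add_mul, ← Matrix.mul_assoc, hB]
    simp only [MorseTransformation.apply, Matrix.mul_assoc, hx, hy]
    simp only [← Matrix.mul_assoc] at this ⊢
    rw [this]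

theorem ControlSystem.RightKernel.apply [Fintype Z]
    {S : ControlSystem X U Y} {P : Matrix Z Z ℝ}
    {T : Matrix X Z ℝ} {F : Matrix U Z ℝ} (h : S.RightKernel P T F)
    (M : MorseTransformation X U Y) :
    (M.apply S).RightKernel P (M.Tx.val * T) (M.Tu.val * (F + M.F * T)) := by
  obtain ⟨hA, hC⟩ := h
  have hx : ∀ {V : Type} (N : Matrix X V ℝ), (M.Tx⁻¹).val * (M.Tx.val * N) = N := fun N => by
    rw [← Matrix.mul_assoc, M.Tx.inv_mul, Matrix.one_mul]
  have hu : ∀ {V : Type} (N : Matrix U V ℝ), (M.Tu⁻¹).val * (M.Tu.val * N) = N := fun N => by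
    rw [← Matrix.mul_assoc, M.Tu.inv_mul, Matrix.one_mul]
  constructor
  · have : (S.A + S.B * M.F + M.K * S.C + M.K * S.D * M.F) * T =
        T * P + (S.B + M.K * S.D) * (F + M.F * T) := by
      simp only [Matrix.mul_add, Matrix.add_mul, Matrix.mul_assoc, hA, hC]
      abel
    simp only [MorseTransformation.apply, Matrix.mul_assoc, hx, hu] at this ⊢
    rw [this, Matrix.mul_add]
  · have : (S.C + S.D * M.F) * T = S.D * (F + M.F * T) := by
      simp only [Matrix.mul_add, Matrix.add_mul, Matrix.mul_assoc, hC]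
    simp only [MorseTransformation.apply, Matrix.mul_assoc, hx, hu] at this ⊢
    rw [this]

section Chains

variable (σ : U → ℕ)

theorem mul_integratorChains_A_succ (T : Matrix Z (Σ i : U, Fin (σ i)) ℝ) (z : Z) (i : U) (j : ℕ)
    (h : j + 1 < σ i) :
    (T * (integratorChains σ).A) z ⟨i, j + 1, h⟩ = T z ⟨i, j, by omega⟩ := by
  rw [Matrix.mul_apply, Finset.sum_eq_single ⟨i, j, by omega⟩]
  · simp [integratorChains]
  · rintro ⟨i', j', hj'⟩ - hne
    have : ¬ (i' = i ∧ j' + 1 = j + 1) := by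
      rintro ⟨rfl, hj⟩
      obtain rfl : j' = j := by omega
      exact hne rfl
    simp only [integratorChains, Matrix.of_apply, if_neg this, mul_zero]
  · simp

theorem mul_integratorChains_B (T : Matrix Z (Σ i : U, Fin (σ i)) ℝ) (z : Z) (i : U) (j : ℕ)
    (h : j + 1 = σ i) :
    (T * (integratorChains σ).B) z i = T z ⟨i, j, by omega⟩ := by
  rw [Matrix.mul_apply, Finset.sum_eq_single ⟨i, j, by omega⟩]
  · simp [integratorChains, h]
  · rintro ⟨i', j', hj'⟩ - hne
    have : ¬ (i' = i ∧ j' + 1 = σ i') := by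
      rintro ⟨rfl, hj⟩
      obtain rfl : j' = j := by omega
      exact hne rfl
    simp only [integratorChains, Matrix.of_apply, if_neg this, mul_zero]
  · simp

theorem mul_integratorChains_C (K : Matrix Z U ℝ) (z : Z) (i : U) (j : Fin (σ i)) :
    (K * (integratorChains σ).C) z ⟨i, j⟩ = if (j : ℕ) = 0 then K z i else 0 := by
  by_cases hj : (j : ℕ) = 0 <;> simp [Matrix.mul_apply, integratorChains, hj]

theorem mul_integratorChains_D (K : Matrix Z U ℝ) (z : Z) (i : U) :
    (K * (integratorChains σ).D) z i = if σ i = 0 then K z i else 0 := by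
  rw [Matrix.mul_apply, Finset.sum_eq_single i]
  · by_cases hi : σ i = 0 <;> simp [integratorChains, hi]
  · intro i' _ hne
    simp [integratorChains, hne]
  · simp

theorem integratorChains_A_mul_of_lt (T : Matrix (Σ i : U, Fin (σ i)) Z ℝ) (z : Z) (i : U) (j : ℕ)
    (h : j + 1 < σ i) :
    ((integratorChains σ).A * T) ⟨i, j, by omega⟩ z = T ⟨i, j + 1, h⟩ z := by
  rw [Matrix.mul_apply, Finset.sum_eq_single ⟨i, j + 1, h⟩]
  · simp [integratorChains]
  · rintro ⟨i', j', hj'⟩ - hne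
    have : ¬ (i = i' ∧ j + 1 = j') := by
      rintro ⟨rfl, rfl⟩
      exact hne rfl
    simp only [integratorChains, Matrix.of_apply, if_neg this, zero_mul]
  · simp

theorem integratorChains_B_mul (F : Matrix U Z ℝ) (z : Z) (i : U) (j : Fin (σ i)) :
    ((integratorChains σ).B * F) ⟨i, j⟩ z = if (j : ℕ) + 1 = σ i then F i z else 0 := by
  by_cases hj : (j : ℕ) + 1 = σ i <;> simp [Matrix.mul_apply, integratorChains, hj]

theorem integratorChains_C_mul (T : Matrix (Σ i : U, Fin (σ i)) Z ℝ) (z : Z) (i : U)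
    (h : 0 < σ i) : ((integratorChains σ).C * T) i z = T ⟨i, 0, h⟩ z := by
  rw [Matrix.mul_apply, Finset.sum_eq_single ⟨i, 0, h⟩]
  · simp [integratorChains]
  · rintro ⟨i', j', hj'⟩ - hne
    have : ¬ (i' = i ∧ j' = 0) := by
      rintro ⟨rfl, rfl⟩
      exact hne rfl
    simp only [integratorChains, Matrix.of_apply, if_neg this, zero_mul]
  · simp

theorem integratorChains_D_mul (F : Matrix U Z ℝ) (z : Z) (i : U) :
    ((integratorChains σ).D * F) i z = if σ i = 0 then F i z else 0 := by
  by_cases hi : σ i = 0 <;> simp [Matrix.mul_apply, integratorChains, hi]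

/-- Along a chain, the columns of `T` vanish one after the other, starting from the input. -/
theorem leftKernel_integratorChains [Fintype Z]
    {P : Matrix Z Z ℝ} {T : Matrix Z (Σ i : U, Fin (σ i)) ℝ}
    {K : Matrix Z U ℝ} (h : (integratorChains σ).LeftKernel P T K) : T = 0 ∧ K = 0 := by
  obtain ⟨hA, hB⟩ := h
  -- Induction on the distance `l` from the input end of the chain.
  have hT : ∀ (i : U) (l j : ℕ) (hj : j + 1 + l = σ i) (z : Z), T z ⟨i, j, by omega⟩ = 0 := by
    intro i l
    induction l with
    | zero =>
      intro j hj z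
      rw [← mul_integratorChains_B σ T z i j hj, hB, mul_integratorChains_D, if_neg (by omega)]
    | succ l ih =>
      intro j hj z
      rw [← mul_integratorChains_A_succ σ T z i j (by omega), hA, Matrix.add_apply,
        mul_integratorChains_C, if_neg (by simp), add_zero, Matrix.mul_apply]
      exact Finset.sum_eq_zero fun z' _ => by rw [ih (j + 1) (by omega) z', mul_zero]
  have hT0 : T = 0 := by
    ext z ⟨i, j, hj⟩
    exact hT i (σ i - (j + 1)) j (by omega) z
  refine ⟨hT0, ?_⟩
  ext z i
  rw [hT0, Matrix.zero_mul] at hA hB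
  rw [Matrix.mul_zero, zero_add] at hA
  by_cases hi : σ i = 0
  · simpa [mul_integratorChains_D, hi] using (congrFun (congrFun hB z) i).symm
  · simpa [mul_integratorChains_C] using
      (congrFun (congrFun hA z) ⟨i, 0, Nat.pos_of_ne_zero hi⟩).symm

/-- Along a chain, the rows of `T` vanish one after the other, starting from the output. -/
theorem rightKernel_integratorChains [Fintype Z]
    {P : Matrix Z Z ℝ} {T : Matrix (Σ i : U, Fin (σ i)) Z ℝ}
    {F : Matrix U Z ℝ} (h : (integratorChains σ).RightKernel P T F) : T = 0 ∧ F = 0 := by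
  obtain ⟨hA, hC⟩ := h
  have hT : ∀ (i : U) (j : ℕ) (hj : j < σ i) (z : Z), T ⟨i, j, hj⟩ z = 0 := by
    intro i j
    induction j with
    | zero =>
      intro hj z
      rw [← integratorChains_C_mul σ T z i hj, hC, integratorChains_D_mul, if_neg (by omega)]
    | succ j ih =>
      intro hj z
      rw [← integratorChains_A_mul_of_lt σ T z i j hj, hA, Matrix.add_apply,
        integratorChains_B_mul, if_neg (by simp; omega), add_zero, Matrix.mul_apply]
      exact Finset.sum_eq_zero fun z' _ => by rw [ih (by omega) z', zero_mul]
  have hT0 : T = 0 := by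
    ext ⟨i, j, hj⟩ z
    exact hT i j hj z
  refine ⟨hT0, ?_⟩
  ext i z
  rw [hT0, Matrix.mul_zero] at hA hC
  rw [Matrix.zero_mul, zero_add] at hA
  by_cases hi : σ i = 0
  · simpa [integratorChains_D_mul, hi] using (congrFun (congrFun hC i) z).symm
  · have h1 : σ i - 1 + 1 = σ i := by omega
    simpa [integratorChains_B_mul, h1] using
      (congrFun (congrFun hA ⟨i, σ i - 1, by omega⟩) z).symm

end Chains

theorem ControlSystem.LeftKernel.of_reindex {X U Y Z X' U' Y' : Type} [Fintype X] [Fintype Y]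
    [Fintype Z] [Fintype X'] [Fintype Y'] {S : ControlSystem X U Y} {eX : X ≃ X'} {eU : U ≃ U'}
    {eY : Y ≃ Y'} {P : Matrix Z Z ℝ}
    {T : Matrix Z X' ℝ} {K : Matrix Z Y' ℝ} (h : (S.reindex eX eU eY).LeftKernel P T K) :
    S.LeftKernel P (T.submatrix id eX) (K.submatrix id eY) := by
  obtain ⟨hA, hB⟩ := h
  constructor
  · ext z x
    have := congrFun (congrFun hA z) (eX x)
    simpa [ControlSystem.reindex, Matrix.mul_apply, ← eX.sum_comp, ← eY.sum_comp] using this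
  · ext z u
    have := congrFun (congrFun hB z) (eU u)
    simpa [ControlSystem.reindex, Matrix.mul_apply, ← eX.sum_comp, ← eY.sum_comp] using this

theorem ControlSystem.RightKernel.of_reindex {X U Y Z X' U' Y' : Type} [Fintype X] [Fintype U]
    [Fintype Z] [Fintype X'] [Fintype U'] {S : ControlSystem X U Y} {eX : X ≃ X'} {eU : U ≃ U'}
    {eY : Y ≃ Y'} {P : Matrix Z Z ℝ} {T : Matrix X' Z ℝ} {F : Matrix U' Z ℝ}
    (h : (S.reindex eX eU eY).RightKernel P T F) :
    S.RightKernel P (T.submatrix eX id) (F.submatrix eU id) := by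
  obtain ⟨hA, hC⟩ := h
  constructor
  · ext x z
    have := congrFun (congrFun hA (eX x)) z
    simpa [ControlSystem.reindex, Matrix.mul_apply, ← eX.sum_comp, ← eU.sum_comp] using this
  · ext y z
    have := congrFun (congrFun hC (eY y)) z
    simpa [ControlSystem.reindex, Matrix.mul_apply, ← eX.sum_comp, ← eU.sum_comp] using this

theorem ControlSystem.Prime.leftKernel [Fintype Z]
    {S : ControlSystem X U Y} (h : S.Prime) {P : Matrix Z Z ℝ}
    {T : Matrix Z X ℝ} {K : Matrix Z Y ℝ} (hk : S.LeftKernel P T K) : T = 0 ∧ K = 0 := by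
  obtain ⟨σ, eX, eY, M, hM⟩ := h
  have hk' := hk.apply M
  rw [hM] at hk'
  obtain ⟨h1, h2⟩ := leftKernel_integratorChains σ hk'.of_reindex
  have h1' : T * (M.Tx⁻¹).val = 0 := by
    ext z x
    simpa using congrFun (congrFun h1 z) (eX.symm x)
  have h2' : (K + T * M.K) * (M.Ty⁻¹).val = 0 := by
    ext z y
    simpa using congrFun (congrFun h2 z) (eY.symm y)
  have hT : T = 0 := by
    rw [← Matrix.mul_one T, ← M.Tx.inv_mul, ← Matrix.mul_assoc, h1', Matrix.zero_mul]
  refine ⟨hT, ?_⟩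
  rw [hT, Matrix.zero_mul, add_zero] at h2'
  rw [← Matrix.mul_one K, ← M.Ty.inv_mul, ← Matrix.mul_assoc, h2', Matrix.zero_mul]

theorem ControlSystem.Prime.rightKernel [Fintype Z]
    {S : ControlSystem X U Y} (h : S.Prime) {P : Matrix Z Z ℝ}
    {T : Matrix X Z ℝ} {F : Matrix U Z ℝ} (hk : S.RightKernel P T F) : T = 0 ∧ F = 0 := by
  obtain ⟨σ, eX, eY, M, hM⟩ := h
  have hk' := hk.apply M
  rw [hM] at hk'
  obtain ⟨h1, h2⟩ := rightKernel_integratorChains σ hk'.of_reindex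
  have h1' : M.Tx.val * T = 0 := by
    ext x z
    simpa using congrFun (congrFun h1 (eX.symm x)) z
  have h2' : M.Tu.val * (F + M.F * T) = 0 := by
    ext u z
    simpa using congrFun (congrFun h2 u) z
  have hT : T = 0 := by
    rw [← Matrix.one_mul T, ← M.Tx.inv_mul, Matrix.mul_assoc, h1', Matrix.mul_zero]
  refine ⟨hT, ?_⟩
  rw [hT, Matrix.mul_zero, add_zero] at h2'
  rw [← Matrix.one_mul F, ← M.Tu.inv_mul, Matrix.mul_assoc, h2', Matrix.mul_zero]

/-- This is the case `K = 0` of the vanishing left kernel; `P` is arbitrary there, which fits the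
matrix form of the Hautus condition. -/
theorem ControlSystem.Prime.hautus {S : ControlSystem X U Y} (h : S.Prime) : Hautus S.A S.B :=
  fun _ P T hA hB =>
    (h.leftKernel (P := P) (T := T) (K := 0) ⟨by simpa using hA, by simpa using hB⟩).1

theorem ControlSystem.Prime.card_eq {S : ControlSystem X U Y} (h : S.Prime) :
    Fintype.card U = Fintype.card Y := by
  obtain ⟨_, _, eY, _⟩ := h
  exact Fintype.card_congr eY

/-- For a prime system the constrained Sylvester equation has a solution after a suitable output
injection. -/
theorem ControlSystem.Prime.exists_left [Fintype Z]
    {S : ControlSystem X U Y} (h : S.Prime) (P : Matrix Z Z ℝ)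
    (G : Matrix Z X ℝ) (H : Matrix Z U ℝ) :
    ∃ (T : Matrix Z X ℝ) (K : Matrix Z Y ℝ),
      T * S.A - P * T - K * S.C = G ∧ T * S.B - K * S.D = H := by
  let f : Matrix Z X ℝ × Matrix Z Y ℝ →ₗ[ℝ] Matrix Z X ℝ × Matrix Z U ℝ :=
    { toFun := fun q => (q.1 * S.A - P * q.1 - q.2 * S.C, q.1 * S.B - q.2 * S.D)
      map_add' := fun q q' => by
        simp only [Prod.fst_add, Prod.snd_add, Matrix.mul_add, Matrix.add_mul, Prod.mk_add_mk]
        congr 1 <;> abel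
      map_smul' := fun c q => by simp [smul_sub] }
  have hf : Function.Injective f := (injective_iff_map_eq_zero f).mpr fun q hq => by
    have h1 : q.1 * S.A - P * q.1 - q.2 * S.C = 0 := congrArg Prod.fst hq
    have h2 : q.1 * S.B - q.2 * S.D = 0 := congrArg Prod.snd hq
    rw [sub_sub] at h1
    have := h.leftKernel ⟨sub_eq_zero.mp h1, sub_eq_zero.mp h2⟩
    exact Prod.ext this.1 this.2
  -- Equality of the numbers of inputs and outputs makes the system square.
  have hfs := (LinearMap.injective_iff_surjective_of_finrank_eq_finrank (by
    simp [Module.finrank_matrix, h.card_eq])).mp hf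
  obtain ⟨q, hq⟩ := hfs (G, H)
  exact ⟨q.1, q.2, congrArg Prod.fst hq, congrArg Prod.snd hq⟩

/-- For a prime system the dual constrained Sylvester equation has a solution after a suitable
feedback. -/
theorem ControlSystem.Prime.exists_right [Fintype Z]
    {S : ControlSystem X U Y} (h : S.Prime) (P : Matrix Z Z ℝ)
    (G : Matrix X Z ℝ) (H : Matrix Y Z ℝ) :
    ∃ (T : Matrix X Z ℝ) (F : Matrix U Z ℝ),
      S.A * T - T * P - S.B * F = G ∧ S.C * T - S.D * F = H := by
  let f : Matrix X Z ℝ × Matrix U Z ℝ →ₗ[ℝ] Matrix X Z ℝ × Matrix Y Z ℝ :=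
    { toFun := fun q => (S.A * q.1 - q.1 * P - S.B * q.2, S.C * q.1 - S.D * q.2)
      map_add' := fun q q' => by
        simp only [Prod.fst_add, Prod.snd_add, Matrix.mul_add, Matrix.add_mul, Prod.mk_add_mk]
        congr 1 <;> abel
      map_smul' := fun c q => by simp [smul_sub] }
  have hf : Function.Injective f := (injective_iff_map_eq_zero f).mpr fun q hq => by
    have h1 : S.A * q.1 - q.1 * P - S.B * q.2 = 0 := congrArg Prod.fst hq
    have h2 : S.C * q.1 - S.D * q.2 = 0 := congrArg Prod.snd hq
    rw [sub_sub] at h1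
    have := h.rightKernel ⟨sub_eq_zero.mp h1, sub_eq_zero.mp h2⟩
    exact Prod.ext this.1 this.2
  have hfs := (LinearMap.injective_iff_surjective_of_finrank_eq_finrank (by
    simp [Module.finrank_matrix, h.card_eq])).mp hf
  obtain ⟨q, hq⟩ := hfs (G, H)
  exact ⟨q.1, q.2, congrArg Prod.fst hq, congrArg Prod.snd hq⟩

end Prime

/-! ### Block computations -/

theorem det_block44_unitriangular {X₁ X₂ X₃ X₄ : Type} [Fintype X₁] [DecidableEq X₁] [Fintype X₂]
    [DecidableEq X₂] [Fintype X₃] [DecidableEq X₃] [Fintype X₄] [DecidableEq X₄]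
    (T₁ : Matrix X₁ X₂ ℝ) (T₂ : Matrix X₁ X₃ ℝ) (T₃ : Matrix X₁ X₄ ℝ) (T₄ : Matrix X₂ X₄ ℝ)
    (T₅ : Matrix X₃ X₄ ℝ) :
    (block44 1 T₁ T₂ T₃ 0 1 0 T₄ 0 0 1 T₅ 0 0 0 1).det = 1 := by
  simp [block44, Matrix.fromBlocks_zero, Matrix.det_fromBlocks_zero₂₁]

section Forms

variable {n₁ n₂ n₃ n₄ m₁ m₃ p₃ p₄ : ℕ}

/-- The blocks obtained from `S` by a feedback and an output injection of the special shape. -/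
def TriangularBlocks.transform (S : TriangularBlocks n₁ n₂ n₃ n₄ m₁ m₃ p₃ p₄)
    (F₁ : Matrix (Fin m₁) (Fin n₁) ℝ) (F₂ : Matrix (Fin m₃) (Fin n₃) ℝ)
    (F₃ : Matrix (Fin m₃) (Fin n₄) ℝ) (K₁ : Matrix (Fin n₁) (Fin p₃) ℝ)
    (K₃ : Matrix (Fin n₄) (Fin p₄) ℝ) : TriangularBlocks n₁ n₂ n₃ n₄ m₁ m₃ p₃ p₄ where
  A₁ := S.A₁ + S.B₁ * F₁
  A₁₂ := S.A₁₂
  A₁₃ := S.A₁₃ + S.B₁₂ * F₂ + K₁ * (S.C₃ + S.D₃ * F₂)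
  A₁₄ := S.A₁₄ + S.B₁₂ * F₃ + K₁ * (S.C₃₄ + S.D₃ * F₃)
  A₂ := S.A₂
  A₂₄ := S.A₂₄
  A₃ := S.A₃ + S.B₃ * F₂
  A₃₄ := S.A₃₄ + S.B₃ * F₃
  A₄ := S.A₄ + K₃ * S.C₄
  B₁ := S.B₁
  B₁₂ := S.B₁₂ + K₁ * S.D₃
  B₃ := S.B₃
  C₃ := S.C₃ + S.D₃ * F₂
  C₃₄ := S.C₃₄ + S.D₃ * F₃
  C₄ := S.C₄
  D₃ := S.D₃

theorem TriangularBlocks.apply_toSystem (S : TriangularBlocks n₁ n₂ n₃ n₄ m₁ m₃ p₃ p₄)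
    (F₁ : Matrix (Fin m₁) (Fin n₁) ℝ) (F₂ : Matrix (Fin m₃) (Fin n₃) ℝ)
    (F₃ : Matrix (Fin m₃) (Fin n₄) ℝ) (K₁ : Matrix (Fin n₁) (Fin p₃) ℝ)
    (K₃ : Matrix (Fin n₄) (Fin p₄) ℝ) :
    (MorseTransformation.mk 1 1 1 (block24 F₁ 0 0 0 0 0 F₂ F₃)
      (block42 K₁ 0 0 0 0 0 0 K₃)).apply S.toSystem =
      (S.transform F₁ F₂ F₃ K₁ K₃).toSystem := by
  ext1
  · simp only [MorseTransformation.apply, TriangularBlocks.toSystem, TriangularBlocks.transform,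
      block44, block42, block24, Matrix.fromRows_mul,
      Matrix.fromBlocks_multiply, Matrix.mul_assoc, Matrix.mul_fromCols]
    ext ((i | i) | (i | i)) ((j | j) | (j | j)) <;>
      simp [Matrix.mul_add, Matrix.mul_assoc, add_assoc]
  · simp only [MorseTransformation.apply, TriangularBlocks.toSystem, TriangularBlocks.transform,
      block42, Matrix.fromRows_mul, Matrix.fromBlocks_multiply]
    ext ((i | i) | (i | i)) (j | j) <;> simp
  · simp only [MorseTransformation.apply, TriangularBlocks.toSystem, TriangularBlocks.transform,
      block24, Matrix.mul_fromCols, Matrix.fromBlocks_multiply]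
    ext (i | i) ((j | j) | (j | j)) <;> simp
  · simp [MorseTransformation.apply, TriangularBlocks.toSystem, TriangularBlocks.transform]

/-- Solutions of the Sylvester equations block-diagonalize the system. -/
theorem TriangularBlocks.SylvesterEquations.intertwine
    {N : TriangularBlocks n₁ n₂ n₃ n₄ m₁ m₃ p₃ p₄}
    {T₁ : Matrix (Fin n₁) (Fin n₂) ℝ} {T₂ : Matrix (Fin n₁) (Fin n₃) ℝ}
    {T₃ : Matrix (Fin n₁) (Fin n₄) ℝ} {T₄ : Matrix (Fin n₂) (Fin n₄) ℝ}
    {T₅ : Matrix (Fin n₃) (Fin n₄) ℝ} (h : N.SylvesterEquations T₁ T₂ T₃ T₄ T₅)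
    {L : Matrix (State4 n₁ n₂ n₃ n₄) (State4 n₁ n₂ n₃ n₄) ℝ}
    (hL : L = block44 1 T₁ T₂ T₃ 0 1 0 T₄ 0 0 1 T₅ 0 0 0 1) :
    N.toSystem.A * L = L * N.diagonalSystem.A ∧ N.toSystem.B = L * N.diagonalSystem.B ∧
      N.toSystem.C * L = N.diagonalSystem.C := by
  subst hL
  have e1 : N.A₁ * T₁ + N.A₁₂ = T₁ * N.A₂ := by
    rw [← sub_eq_zero, add_sub_right_comm, h.eq₁, neg_add_cancel]
  have e2 : N.A₁ * T₂ + N.A₁₃ = T₂ * N.A₃ := by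
    rw [← sub_eq_zero, add_sub_right_comm, h.eq₂, neg_add_cancel]
  have e4 : N.A₂ * T₄ + N.A₂₄ = T₄ * N.A₄ := by
    rw [← sub_eq_zero, add_sub_right_comm, h.eq₄, neg_add_cancel]
  have e5 : N.A₃ * T₅ + N.A₃₄ = T₅ * N.A₄ := by
    rw [← sub_eq_zero, add_sub_right_comm, h.eq₅, neg_add_cancel]
  have e3 : N.A₁ * T₃ + N.A₁₂ * T₄ + (N.A₁₃ * T₅ + N.A₁₄) = T₃ * N.A₄ := by
    have h3 := h.eq₃
    rw [sub_eq_iff_eq_add] at h3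
    rw [h3]
    abel
  refine ⟨?_, ?_, ?_⟩
  · simp [TriangularBlocks.toSystem, TriangularBlocks.diagonalSystem, block44,
      Matrix.fromBlocks_multiply, Matrix.fromBlocks_add, e1, e2, e3, e4, e5]
  · simp [TriangularBlocks.toSystem, TriangularBlocks.diagonalSystem, block44, block42,
      Matrix.fromBlocks_mul_fromRows, Matrix.fromBlocks_multiply, Matrix.fromBlocks_add,
      h.constraint₂]
  · simp [TriangularBlocks.toSystem, TriangularBlocks.diagonalSystem, block44, block24,
      Matrix.fromCols_mul_fromBlocks, Matrix.fromBlocks_multiply, h.constraint₅]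

end Forms

/-- The state change acts after the feedback and injection, by conjugation. The hypotheses use `T⁻¹`
because that is the matrix which the Sylvester solutions give explicitly. -/
theorem MorseTransformation.apply_eq_of_intertwine {X U Y : Type} [Fintype X] [DecidableEq X]
    [Fintype U] [DecidableEq U] [Fintype Y] [DecidableEq Y] {S N D : ControlSystem X U Y}
    {F : Matrix U X ℝ} {K : Matrix X Y ℝ} {T : GL X ℝ}
    (hN : (MorseTransformation.mk 1 1 1 F K).apply S = N)
    (hA : N.A * (T⁻¹).val = (T⁻¹).val * D.A) (hB : N.B = (T⁻¹).val * D.B)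
    (hC : N.C * (T⁻¹).val = D.C) (hD : N.D = D.D) :
    (MorseTransformation.mk T 1 1 F K).apply S = D := by
  subst hN
  have hT : ∀ {V : Type} (M : Matrix X V ℝ), T.val * ((T⁻¹).val * M) = M := fun M => by
    rw [← Matrix.mul_assoc, T.mul_inv, Matrix.one_mul]
  simp only [MorseTransformation.apply, inv_one, Units.val_one, Matrix.one_mul,
    Matrix.mul_one] at hA hB hC hD ⊢
  ext1
  · simp only [Matrix.mul_assoc T.val, hA, hT]
  · simp only [hB, hT]
  · exact hC
  · exact hD

theorem Matrix.spectrum_complex_finite {X : Type} [Fintype X] [DecidableEq X] (A : Matrix X X ℂ) :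
    (spectrum ℂ A).Finite := by
  refine (A.charpoly.roots.toFinset.finite_toSet).subset fun z hz => ?_
  simpa [A.charpoly_monic.ne_zero] using Matrix.mem_spectrum_iff_isRoot_charpoly.mp hz

/-! ### Assembly of the normal form -/

theorem proposition5 (n₁ n₂ n₃ n₄ m₁ m₃ p₃ p₄ : ℕ)
    (S : TriangularBlocks n₁ n₂ n₃ n₄ m₁ m₃ p₃ p₄) (hS : S.Admissible) :
    ∃ (F : Matrix (Fin m₁ ⊕ Fin m₃) (State4 n₁ n₂ n₃ n₄) ℝ)
      (K : Matrix (State4 n₁ n₂ n₃ n₄) (Fin p₃ ⊕ Fin p₄) ℝ)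
      (T : GL (State4 n₁ n₂ n₃ n₄) ℝ)
      (N : TriangularBlocks n₁ n₂ n₃ n₄ m₁ m₃ p₃ p₄),
      -- feedback and injection of the prescribed shape separate the spectra
      (∃ (F₁ : Matrix (Fin m₁) (Fin n₁) ℝ) (F₂ : Matrix (Fin m₃) (Fin n₃) ℝ)
          (F₃ : Matrix (Fin m₃) (Fin n₄) ℝ),
        F = block24
          F₁ 0 0  0
          0  0 F₂ F₃) ∧
      (∃ (K₁ : Matrix (Fin n₁) (Fin p₃) ℝ) (K₂ : Matrix (Fin n₃) (Fin p₃) ℝ)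
          (K₃ : Matrix (Fin n₄) (Fin p₄) ℝ),
        K = block42
          K₁ 0
          0  0
          K₂ 0
          0  K₃) ∧
      (MorseTransformation.mk 1 1 1 F K).apply S.toSystem = N.toSystem ∧
      N.MutuallyDisjointSpectra ∧
      -- the state transformation comes from the (constrained) Sylvester equations
      (∃ (T₁ : Matrix (Fin n₁) (Fin n₂) ℝ) (T₂ : Matrix (Fin n₁) (Fin n₃) ℝ)
          (T₃ : Matrix (Fin n₁) (Fin n₄) ℝ) (T₄ : Matrix (Fin n₂) (Fin n₄) ℝ)
          (T₅ : Matrix (Fin n₃) (Fin n₄) ℝ),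
        N.SylvesterEquations T₁ T₂ T₃ T₄ T₅ ∧
        (T⁻¹).val = block44
          1 T₁ T₂ T₃
          0 1  0  T₄
          0 0  1  T₅
          0 0  0  1) ∧
      -- the Morse transformation leads to the normal form
      (MorseTransformation.mk T 1 1 F K).apply S.toSystem = N.diagonalSystem ∧
      N.Admissible := by
  -- Each choice avoids the spectra already fixed, starting from the immovable `A₂`. `F₂` must be
  -- fixed before the constrained equations, which involve the block after feedback.
  obtain ⟨F₁, hF₁⟩ := hS.controllable.hautus.exists_feedback_disjoint
    (Matrix.spectrum_complex_finite (S.A₂.map Complex.ofReal))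
  obtain ⟨K₃, hK₃⟩ := hS.observable.exists_injection_disjoint
    ((Matrix.spectrum_complex_finite ((S.A₁ + S.B₁ * F₁).map Complex.ofReal)).union
      (Matrix.spectrum_complex_finite (S.A₂.map Complex.ofReal)))
  obtain ⟨F₂, hF₂⟩ := hS.prime.hautus.exists_feedback_disjoint
    (((Matrix.spectrum_complex_finite ((S.A₁ + S.B₁ * F₁).map Complex.ofReal)).union
      (Matrix.spectrum_complex_finite (S.A₂.map Complex.ofReal))).union
      (Matrix.spectrum_complex_finite ((S.A₄ + K₃ * S.C₄).map Complex.ofReal)))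
  rw [Set.disjoint_union_right] at hK₃
  rw [Set.disjoint_union_right, Set.disjoint_union_right] at hF₂
  have hprime := hS.prime.feedback F₂
  obtain ⟨T₂, K₁, hT₂, hT₂'⟩ := hprime.exists_left (S.A₁ + S.B₁ * F₁)
    (S.A₁₃ + S.B₁₂ * F₂) S.B₁₂
  obtain ⟨T₅, F₃', hT₅, hT₅'⟩ := hprime.exists_right (S.A₄ + K₃ * S.C₄) (-S.A₃₄) (-S.C₃₄)
  -- The feedback enters `exists_right` with a minus sign but the transformed blocks with a plus
  -- sign.
  obtain ⟨F₃, rfl⟩ : ∃ F₃, F₃' = -F₃ := ⟨-F₃', by simp⟩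
  simp only [Matrix.mul_neg, sub_neg_eq_add] at hT₂ hT₂' hT₅ hT₅'
  set N := S.transform F₁ F₂ F₃ K₁ K₃ with hN
  -- The diagonal blocks of `N` do not depend on `K₁` and `F₃`, so the earlier separation still
  -- applies.
  have hspec : N.MutuallyDisjointSpectra :=
    ⟨hF₁, hF₂.1.1.symm, hK₃.1.symm, hF₂.1.2.symm, hK₃.2.symm, hF₂.2⟩
  obtain ⟨T₁, hT₁⟩ := hspec.h₁₂.exists_sylvester (-N.A₁₂)
  obtain ⟨T₄, hT₄⟩ := hspec.h₂₄.exists_sylvester (-N.A₂₄)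
  -- Solved last, since `T₄` and `T₅` occur on the right.
  obtain ⟨T₃, hT₃⟩ := hspec.h₁₄.exists_sylvester (-N.A₁₄ - N.A₁₂ * T₄ - N.A₁₃ * T₅)
  have hsyl : N.SylvesterEquations T₁ T₂ T₃ T₄ T₅ := by
    refine ⟨hT₁, hT₄, hT₃, ?_, ?_, ?_, ?_⟩
    · simp only [hN, TriangularBlocks.transform]
      rw [← hT₂]
      abel
    · simp only [hN, TriangularBlocks.transform]
      rw [← sub_eq_iff_eq_add]
      exact hT₂'
    · simp only [hN, TriangularBlocks.transform]
      rw [neg_add, ← hT₅]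
      abel
    · simp only [hN, TriangularBlocks.transform]
      rw [neg_add, ← hT₅']
      abel
  let L : GL (State4 n₁ n₂ n₃ n₄) ℝ := Matrix.GeneralLinearGroup.mkOfDetNeZero
    (block44 1 T₁ T₂ T₃ 0 1 0 T₄ 0 0 1 T₅ 0 0 0 1)
    (by rw [det_block44_unitriangular]; exact one_ne_zero)
  have hL : ((L⁻¹)⁻¹).val = block44 1 T₁ T₂ T₃ 0 1 0 T₄ 0 0 1 T₅ 0 0 0 1 := by
    rw [inv_inv]
    rfl
  have happly := S.apply_toSystem F₁ F₂ F₃ K₁ K₃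
  obtain ⟨hA, hB, hC⟩ := hsyl.intertwine hL
  -- The block `K₂` can be taken to be `0`: feedback alone already moves the spectrum of `A₃`.
  exact ⟨_, _, L⁻¹, N, ⟨F₁, F₂, F₃, rfl⟩, ⟨K₁, 0, K₃, rfl⟩, happly, hspec,
    ⟨T₁, T₂, T₃, T₄, T₅, hsyl, hL⟩,
    MorseTransformation.apply_eq_of_intertwine happly hA hB hC rfl,
    ⟨hS.controllable.add_mul F₁, hS.observable.add_mul K₃, hprime⟩⟩
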